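/- Let $E_1,E_2$ be finite-dimensional real normed spaces, with dual norms on $E_1^*,E_2^*$, and let $A:E_1\to E_2^*$ be linear, with operator norm $\|A\|$ and transpose $A^\top:E_2\to E_1^*$. Let $Q_1\subseteq E_1$ be nonempty and convex, and let $\Omega:Q_1\to\mathbb R$ be $\lambda$-strongly convex with respect to the norm of $E_1$, $\lambda>0$, and such that its extension by $+\infty$ is lower semicontinuous (for instance: $Q_1$ closed and $\Omega$ lower semicontinuous on $Q_1$). Let $Q_2\subseteq E_2$ be closed and convex, and let $g$ be a real function that is convex on $Q_2$ and differentiable at the points of $Q_2$, with $L_g$-Lipschitz gradient on $Q_2$. Here a function $h$ is $m$-strongly convex if $h(tx+(1-t)y)\le t\,h(x)+(1-t)h(y)-\frac m2t(1-t)\|x-y\|^2$ for $t\in[0,1]$ and $x,y$ in its domain. Consider $$\min_{w\in Q_1}J(w),\qquad J(w)=\Omega(w)+g^\star(Aw),\qquad g^\star(s)=\sup_{\alpha\in Q_2}\{\langle s,\alpha\rangle-g(\alpha)\}.$$ Let $d_2$ be lower semicontinuous and $\sigma_2$-strongly convex on $Q_2$ with respect to the norm of $E_2$, $\sigma_2>0$,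 with $\min_{Q_2}d_2=0$ and $D:=\max_{Q_2}d_2\in(0,\infty)$. Let $u_0\in Q_2$ be a point where $d_2$ is differentiable, and put $\Delta(\alpha,\beta)=d_2(\alpha)-d_2(\beta)-\langle\nabla d_2(\beta),\alpha-\beta\rangle$ and $M:=\max_{\alpha\in Q_2}\Delta(\alpha,u_0)$. (Both maxima may be read as suprema.) Let $\epsilon>0$, $\mu=\epsilon/D$, and on $Q_2$ consider $$-D_\mu=f+\Psi,\quad f(\alpha)=g(\alpha)+\Omega^\star(-A^\top\alpha),\quad \Omega^\star(s)=\sup_{w\in Q_1}\{\langle s,w\rangle-\Omega(w)\},\quad \Psi=\mu d_2,\quad L_f=\frac{\|A\|^2}{\lambda}+L_g,$$ and assume $L_f>0$. The primal-dual AGM-EF-$\infty$ scheme for $-D_\mu$ is the following. Set $x_0=z_0=u_0$, $A_0=0$, $\psi_0(\alpha)=\Delta(\alpha,u_0)$. For $k=0,1,\dots$ let $a_{k+1}>0$ be the positive root $a$ of $(a+A_k)(\mu A_k+1)+a\mu A_k=L_f\sigma_2^{-1}a^2$, and put $$A_{k+1}=A_k+a_{k+1},\qquad \tau_1=1+\mu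 A_k,\qquad \tau_3=\mu a_{k+1}\frac{A_k}{A_{k+1}},\qquad \tau=\tau_1+\tau_3,$$ $$u_{k+1}=\frac{a_{k+1}\tau_1z_k+(\tau A_k+\tau_3a_{k+1})x_k}{\tau A_{k+1}},$$ $$\psi_{k+1}(\alpha)=\psi_k(\alpha)+a_{k+1}\big[\Psi(\alpha)+f(u_{k+1})+\langle\nabla f(u_{k+1}),\alpha-u_{k+1}\rangle\big],$$ $$z_{k+1}=\operatorname*{argmin}_{\alpha\in Q_2}\psi_{k+1}(\alpha),\qquad x_{k+1}=\frac{A_kx_k+a_{k+1}z_{k+1}}{A_{k+1}}.$$ The primal iterates are $w_k=\frac1{A_k}\sum_{i=1}^ka_i\,w(u_i)$ for $k\ge1$, where $w(\alpha)=\operatorname*{argmin}_{w\in Q_1}\{\Omega(w)+\langle Aw,\alpha\rangle\}$. Then $f$ is differentiable at the points of $Q_2$ and its gradient is $L_f$-Lipschitz on $Q_2$; the scheme can be run from $u_0$; and for every run from $u_0$ and every integer $k\ge1$ with $$k\ \ge\ \min\left\{\frac1{\sqrt\epsilon}\sqrt{\frac{4M(\|A\|^2+\lambda L_g)}{\lambda\sigma_2}}-1,\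 \ 1+\frac12\,\frac{\ln\!\Big(\frac{4M(\|A\|^2+\lambda L_g)}{\lambda\sigma_2\epsilon}\Big)}{\ln\!\Big(1+\sqrt{\frac{\lambda\epsilon\sigma_2}{4D(\|A\|^2+\lambda L_g)}}\Big)}\right\},$$ the point $w_k$ is a $2\epsilon$-accurate solution of the primal problem: $w_k\in Q_1$ and $J(w_k)\le\inf_{w\in Q_1}J(w)+2\epsilon$. -/

import Mathlib

/-! ## Convex analysis -/

/-- The Fenchel dual `h*(s) = sup_{x ∈ Q} (⟨s, x⟩ - h x)` of the function that equals `h` on `Q` and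
`+∞` off `Q`.  It is real valued: for the functions below (strongly convex and closed, or
continuous on a compact set) the supremum is finite. -/
noncomputable def fenchelDual {E : Type*} [NormedAddCommGroup E] [NormedSpace ℝ E]
    (Q : Set E) (h : E → ℝ) (s : E →L[ℝ] ℝ) : ℝ :=
  sSup ((fun x => s x - h x) '' Q)

/-- The function equal to `h` on `Q` and `+∞` off `Q` is lower semicontinuous: its epigraph is
closed.  This holds in particular if `Q` is closed and `h` is lower semicontinuous on `Q`. -/
def IsClosedFunctionOn {E : Type*} [NormedAddCommGroup E] [NormedSpace ℝ E]
    (Q : Set E) (h : E → ℝ) : Prop :=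
  IsClosed {p : E × ℝ | p.1 ∈ Q ∧ h p.1 ≤ p.2}

/-- `f` is differentiable at the points of `Q`, and its gradient is `L`-Lipschitz on `Q` (from the
norm of `E` to the dual norm). -/
def IsLCGOn {E : Type*} [NormedAddCommGroup E] [NormedSpace ℝ E]
    (Q : Set E) (f : E → ℝ) (L : ℝ) : Prop :=
  (∀ x ∈ Q, DifferentiableAt ℝ f x) ∧
    ∀ x ∈ Q, ∀ y ∈ Q, ‖fderiv ℝ f x - fderiv ℝ f y‖ ≤ L * ‖x - y‖

/-- The Bregman divergence `Δ_d(x, y) = d x - d y - ⟨∇d(y), x - y⟩`. -/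
noncomputable def bregman {E : Type*} [NormedAddCommGroup E] [NormedSpace ℝ E]
    (d : E → ℝ) (x y : E) : ℝ :=
  d x - d y - fderiv ℝ d y (x - y)

/-- `ℓ_f(x; y, λ₁) = f y + ⟨∇f(y), x - y⟩ + λ₁ Δ_d(x, y)`. -/
noncomputable def lowerModel {E : Type*} [NormedAddCommGroup E] [NormedSpace ℝ E]
    (f d : E → ℝ) (lam₁ : ℝ) (x y : E) : ℝ :=
  f y + fderiv ℝ f y (x - y) + lam₁ * bregman d x y

/-- `w` is a `δ`-accurate solution of the problem of minimizing `J` over `Q`. -/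
def IsAccurateSolution {E : Type*} (Q : Set E) (J : E → ℝ) (δ : ℝ) (w : E) : Prop :=
  w ∈ Q ∧ ∀ v ∈ Q, J w ≤ J v + δ

/-! ## The ∞-memory accelerated gradient method (AGM-EF-∞) -/

/-- The estimation functions `ψ₀(y) = Δ_d(y, x₀)` and
`ψ_{k+1}(y) = ψ_k(y) + a_{k+1} (Ψ(y) + ℓ_f(y; u_{k+1}, λ₁))`. -/
noncomputable def estimateFun {E : Type*} [NormedAddCommGroup E] [NormedSpace ℝ E]
    (f Ψ d : E → ℝ) (lam₁ : ℝ) (x₀ : E) (u : ℕ → E) (a : ℕ → ℝ) : ℕ → E → ℝ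
  | 0, y => bregman d y x₀
  | k + 1, y => estimateFun f Ψ d lam₁ x₀ u a k y +
      a (k + 1) * (Ψ y + lowerModel f d lam₁ y (u (k + 1)))

/-- The sequences `x, u, z` (points) and `a, A` (weights) are produced by AGM-EF-∞, started at
`x₀`, for minimizing `f + Ψ` where `dom Ψ = Q`, `f` is `lam₁`-strongly convex and `Ψ` is
`lam₂`-strongly convex with respect to the prox-function `d`, `d` is `σ`-strongly convex with
respect to the norm, and `L` is the Lipschitz constant of the gradient of `f`.
The entries `u 0` and `a 0` are not used. -/
structure IsAGMEFInf {E : Type*} [NormedAddCommGroup E] [NormedSpace ℝ E]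
    (Q : Set E) (f Ψ d : E → ℝ) (lam₁ lam₂ σ L : ℝ) (x₀ : E)
    (x u z : ℕ → E) (a A : ℕ → ℝ) : Prop where
  x_zero : x 0 = x₀
  z_zero : z 0 = x₀
  A_zero : A 0 = 0
  a_pos : ∀ k, 0 < a (k + 1)
  a_root : ∀ k,
    (a (k + 1) + A k) * (lam₁ * a (k + 1) + (lam₁ + lam₂) * A k + 1) + a (k + 1) * lam₂ * A k
      = L * σ⁻¹ * a (k + 1) ^ 2
  A_succ : ∀ k, A (k + 1) = A k + a (k + 1)
  u_succ : ∀ k, ∀ τ₁ τ₂ τ₃ τ : ℝ,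
    τ₁ = 1 + (lam₁ + lam₂) * A k →
    τ₂ = lam₁ * a (k + 1) →
    τ₃ = lam₂ * a (k + 1) * (A k / A (k + 1)) →
    τ = τ₁ + τ₂ + τ₃ →
    u (k + 1) = (τ * A (k + 1) - τ₂ * a (k + 1))⁻¹ •
      ((a (k + 1) * τ₁) • z k + (τ * A k + τ₃ * a (k + 1)) • x k)
  z_mem : ∀ k, z (k + 1) ∈ Q
  z_isMinOn : ∀ k, IsMinOn (estimateFun f Ψ d lam₁ x₀ u a (k + 1)) Q (z (k + 1))
  x_succ : ∀ k, x (k + 1) = (A (k + 1))⁻¹ • (A k • x k + a (k + 1) • z (k + 1))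

/-! ## Regularized risk minimization and the smoothed dual

`A : E₁ → E₂*` is linear, `⟨A w, α⟩ = A w α`, and `A.flip α = Aᵀ α ∈ E₁*`.  The norm of `A` is the
operator norm, i.e. the maximum of `⟨A w, α⟩` over unit vectors `w` and `α`. -/

section RRM

variable {E₁ E₂ : Type*} [NormedAddCommGroup E₁] [NormedSpace ℝ E₁]
  [NormedAddCommGroup E₂] [NormedSpace ℝ E₂]

/-- The primal objective `J(w) = Ω(w) + g*(A w)`, for `w ∈ Q₁`. -/
noncomputable def primalObj (Q₂ : Set E₂) (Ω : E₁ → ℝ) (g : E₂ → ℝ)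
    (A : E₁ →L[ℝ] E₂ →L[ℝ] ℝ) (w : E₁) : ℝ :=
  Ω w + fenchelDual Q₂ g (A w)

/-- `f(α) = g(α) + Ω*(-Aᵀ α)`, so that `-D_μ = f + μ d₂` on `Q₂`. -/
noncomputable def dualSmoothPart (Q₁ : Set E₁) (Ω : E₁ → ℝ) (g : E₂ → ℝ)
    (A : E₁ →L[ℝ] E₂ →L[ℝ] ℝ) (α : E₂) : ℝ :=
  g α + fenchelDual Q₁ Ω (-(A.flip α))

/-- The primal-dual scheme applied to `-D_μ = f + Ψ` with `f(α) = g(α) + Ω*(-Aᵀ α)` and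
`Ψ = μ d₂` on `Q₂`: AGM-EF-∞ with prox-function `d₂` and with `λ₁ = 0`, `λ₂ = μ`, together with
`v i`, the minimizer of `Ω(w) + ⟨A w, u_i⟩` over `w ∈ Q₁`, for `i ≥ 1`.  The sequence of weights
`A_k` of the algorithm is called `S` here. -/
structure IsPrimalDualScheme (Q₁ : Set E₁) (Q₂ : Set E₂) (Ω : E₁ → ℝ) (g d₂ : E₂ → ℝ)
    (A : E₁ →L[ℝ] E₂ →L[ℝ] ℝ) (μ σ₂ L : ℝ) (u₀ : E₂)
    (x u z : ℕ → E₂) (a S : ℕ → ℝ) (v : ℕ → E₁) : Prop where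
  agm : IsAGMEFInf Q₂ (dualSmoothPart Q₁ Ω g A) (fun α => μ * d₂ α) d₂ 0 μ σ₂ L u₀ x u z a S
  v_mem : ∀ i, v (i + 1) ∈ Q₁
  v_isMinOn : ∀ i, IsMinOn (fun w => Ω w + A w (u (i + 1))) Q₁ (v (i + 1))

end RRM

/-- The primal iterate `w_k = (1 / S_k) ∑_{i=1}^k a_i v_i`, for `k ≥ 1`. -/
noncomputable def primalIterate {E : Type*} [NormedAddCommGroup E] [NormedSpace ℝ E]
    (a S : ℕ → ℝ) (v : ℕ → E) (k : ℕ) : E :=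
  (S k)⁻¹ • ∑ i ∈ Finset.Icc 1 k, a i • v i

/-! The proof is an estimate-sequence argument combined with weak duality. The invariant
`mul_objective_le` says `S_k (f + μ d₂)(x_k) ≤ ψ_k(z_k)`, and `ψ_k(z_k) ≤ ψ_k(α)` for every `α ∈
Q₂`. The gradient of `f` at `u_i` is `∇g(u_i) - A v_i` (Danskin), so by convexity of `g` the linear
model of `f` at `u_i` is at most `g α - Ω(v_i) - ⟨A v_i, α⟩`. Averaging with weights `a_i / S_k` and
using convexity of `Ω` replaces the `v_i` by the primal iterate `w_k`. The supremum over `α` then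
gives `J(w_k) ≤ -f(x_k) + μ D + M / S_k`, while weak duality gives `-f(x_k) ≤ J(w)` for every `w ∈
Q₁` (`IsPrimalDualScheme.isAccurateSolution`). Since `μ D = ε`, it remains to have `S_k ≥ M / ε`.
The equation for `a_{k+1}` makes `√S_k` grow at least linearly and at least geometrically
(`sqrt_weight_succ`); the two terms of the minimum are these two growth rates. -/

open Filter Topology

/-! ### Strong convexity, existence of minimizers, Fenchel duals, descent lemma -/

section ConvexAnalysis

variable {E : Type*} [NormedAddCommGroup E] [NormedSpace ℝ E]

theorem StrongConvexOn.le_segment {Q : Set E} {m : ℝ} {h : E → ℝ} (hh : StrongConvexOn Q m h)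
    {x y : E} (hx : x ∈ Q) (hy : y ∈ Q) {t : ℝ} (ht : t ∈ Set.Icc (0 : ℝ) 1) :
    h (x + t • (y - x)) ≤ h x + t * (h y - h x - (1 - t) * (m / 2 * ‖y - x‖ ^ 2)) := by
  have key := hh.2 hy hx ht.1 (sub_nonneg.2 ht.2) (by ring)
  have e : x + t • (y - x) = t • y + (1 - t) • x := by module
  rw [e]
  refine key.trans (le_of_eq ?_)
  simp only [smul_eq_mul]
  ring

/-- The limit `t → 0` in a strong convexity inequality already divided by `t`. -/
theorem le_of_forall_one_sub_mul_le {c d : ℝ}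
    (h : ∀ t : ℝ, 0 < t → t < 1 → (1 - t) * c ≤ d) : c ≤ d := by
  have h1 : Tendsto (fun t : ℝ => (1 - t) * c) (𝓝[>] 0) (𝓝 c) := by
    have : Continuous fun t : ℝ => (1 - t) * c := by fun_prop
    simpa using (this.tendsto 0).mono_left nhdsWithin_le_nhds
  refine le_of_tendsto h1 ?_
  filter_upwards [Ioo_mem_nhdsGT (zero_lt_one' ℝ)] with t ht using h t ht.1 ht.2

/-- Quadratic growth of a strongly convex function at a minimizer. -/
theorem StrongConvexOn.add_sq_le_of_isMinOn {Q : Set E} {m : ℝ} {h : E → ℝ}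
    (hh : StrongConvexOn Q m h) {x y : E} (hx : x ∈ Q) (hmin : IsMinOn h Q x) (hy : y ∈ Q) :
    h x + m / 2 * ‖y - x‖ ^ 2 ≤ h y := by
  suffices m / 2 * ‖y - x‖ ^ 2 ≤ h y - h x by linarith
  refine le_of_forall_one_sub_mul_le fun t ht0 ht1 => ?_
  have h1 := hh.le_segment hx hy ⟨ht0.le, ht1.le⟩
  have h2 : h x ≤ h (x + t • (y - x)) :=
    hmin (hh.1.add_smul_sub_mem hx hy ⟨ht0.le, ht1.le⟩)
  have h3 : 0 ≤ t * (h y - h x - (1 - t) * (m / 2 * ‖y - x‖ ^ 2)) := by linarith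
  linarith [nonneg_of_mul_nonneg_right h3 ht0]

theorem DifferentiableAt.hasDerivAt_comp_segment {h : E → ℝ} {x y : E} {t : ℝ}
    (hd : DifferentiableAt ℝ h (x + t • (y - x))) :
    HasDerivAt (fun s : ℝ => h (x + s • (y - x))) (fderiv ℝ h (x + t • (y - x)) (y - x)) t := by
  have h1 : HasDerivAt (fun s : ℝ => x + s • (y - x)) (y - x) t := by
    simpa using ((hasDerivAt_id t).smul_const (y - x)).const_add x
  exact hd.hasFDerivAt.comp_hasDerivAt t h1

/-- The first-order characterization of strong convexity. -/
theorem StrongConvexOn.first_order_le {Q : Set E} {m : ℝ} {h : E → ℝ}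
    (hh : StrongConvexOn Q m h) {x y : E} (hx : x ∈ Q) (hd : DifferentiableAt ℝ h x) (hy : y ∈ Q) :
    h x + fderiv ℝ h x (y - x) + m / 2 * ‖y - x‖ ^ 2 ≤ h y := by
  have hd' : DifferentiableAt ℝ h (x + (0 : ℝ) • (y - x)) := by simpa using hd
  have h1 := hd'.hasDerivAt_comp_segment.tendsto_slope_zero_right
  have h2 : Tendsto (fun t : ℝ => h y - h x - (1 - t) * (m / 2 * ‖y - x‖ ^ 2)) (𝓝[>] 0)
      (𝓝 (h y - h x - m / 2 * ‖y - x‖ ^ 2)) := by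
    have : Continuous fun t : ℝ => h y - h x - (1 - t) * (m / 2 * ‖y - x‖ ^ 2) := by fun_prop
    simpa using (this.tendsto 0).mono_left nhdsWithin_le_nhds
  have h3 := le_of_tendsto_of_tendsto h1 h2 (by
    filter_upwards [Ioo_mem_nhdsGT (zero_lt_one' ℝ)] with t ht
    have h4 := hh.le_segment hx hy ⟨ht.1.le, ht.2.le⟩
    rw [smul_eq_mul, inv_mul_le_iff₀ ht.1]
    simp only [zero_add, zero_smul, add_zero]
    linarith)
  simp only [zero_smul, add_zero] at h3
  linarith

theorem StrongConvexOn.const_mul_add_affine {Q : Set E} {m : ℝ} {h : E → ℝ}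
    (hh : StrongConvexOn Q m h) {c : ℝ} (hc : 0 ≤ c) (b : ℝ) (l : E →L[ℝ] ℝ) :
    StrongConvexOn Q (c * m) (fun y => c * h y + (b + l y)) := by
  refine ⟨hh.1, fun x hx y hy s t hs ht hst => ?_⟩
  have key := mul_le_mul_of_nonneg_left (hh.2 hx hy hs ht hst) hc
  simp only [smul_eq_mul, map_add, map_smul] at key ⊢
  have hb : b = s * b + t * b := by rw [← add_mul, hst, one_mul]
  linear_combination key + hb

/-- A closed convex function has an affine minorant. -/
theorem IsClosedFunctionOn.exists_affine_le {Q : Set E} {h : E → ℝ} (hh : ConvexOn ℝ Q h)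
    (hcl : IsClosedFunctionOn Q h) (hQ : Q.Nonempty) :
    ∃ (b : ℝ) (l : E →L[ℝ] ℝ), ∀ y ∈ Q, b + l y ≤ h y := by
  obtain ⟨x₀, hx₀⟩ := hQ
  -- A point one unit below the graph is separated from the epigraph; comparing it with the point
  -- above it shows that the hyperplane is not vertical.
  obtain ⟨φ, r, h1, h2⟩ := geometric_hahn_banach_point_closed (x := (x₀, h x₀ - 1))
    hh.convex_epigraph hcl (by simp)
  have split : ∀ (y : E) (s : ℝ), φ (y, s) = φ (y, 0) + s * φ (0, 1) := fun y s => by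
    rw [← smul_eq_mul, ← map_smul, ← map_add]; simp
  have hβ : 0 < φ (0, 1) := by
    have h3 := h1.trans (h2 (x₀, h x₀) ⟨hx₀, le_rfl⟩)
    rw [split x₀ (h x₀ - 1), split x₀ (h x₀)] at h3
    linarith
  refine ⟨r / φ (0, 1), -((φ (0, 1))⁻¹ • φ.comp (ContinuousLinearMap.inl ℝ E ℝ)),
    fun y hy => ?_⟩
  have h3 := h2 (y, h y) ⟨hy, le_rfl⟩
  rw [split] at h3
  have e : r / φ (0, 1) + (-((φ (0, 1))⁻¹ • φ.comp (ContinuousLinearMap.inl ℝ E ℝ))) y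
      = (r - φ (y, 0)) / φ (0, 1) := by
    simp [ContinuousLinearMap.inl_apply]; ring
  rw [e, div_le_iff₀ hβ]
  linarith

/-- A closed strongly convex function on a finite-dimensional space has a minimizer. -/
theorem IsClosedFunctionOn.exists_isMinOn [FiniteDimensional ℝ E] {Q : Set E} {m : ℝ} {h : E → ℝ}
    (hcl : IsClosedFunctionOn Q h) (hh : StrongConvexOn Q m h) (hm : 0 < m) (hQ : Q.Nonempty) :
    ∃ x ∈ Q, IsMinOn h Q x := by
  obtain ⟨b, l, hbl⟩ := IsClosedFunctionOn.exists_affine_le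
    (strongConvexOn_zero.1 (hh.mono hm.le)) hcl hQ
  obtain ⟨x₀, hx₀⟩ := hQ
  set C := h x₀ - b - l x₀ with hC
  -- Strong convexity bounds `h` above at the midpoint of `x₀` and `y`, the affine minorant bounds
  -- it below; the sublevel set of `h x₀` is therefore bounded.
  have hgrow : ∀ y ∈ Q, h y ≤ h x₀ → m / 4 * ‖y - x₀‖ ^ 2 ≤ 2 * C + ‖l‖ * ‖y - x₀‖ := by
    intro y hy hyx
    have hhalf : (1 / 2 : ℝ) ∈ Set.Icc (0 : ℝ) 1 := by norm_num
    have h1 := hh.le_segment hx₀ hy hhalf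
    have h2 := hbl _ (hh.1.add_smul_sub_mem hx₀ hy hhalf)
    have h3 := (abs_le.1 (l.le_opNorm (y - x₀))).1
    simp only [map_add, map_smul, smul_eq_mul] at h2
    linarith
  obtain ⟨R, hR⟩ : ∃ R, ∀ y ∈ Q, h y ≤ h x₀ → ‖y - x₀‖ ≤ R := by
    refine ⟨1 + 4 / m * (2 * C + ‖l‖), fun y hy hyx => ?_⟩
    have h1 := hgrow y hy hyx
    have hC0 : 0 ≤ C := by linarith [hbl x₀ hx₀]
    have hl := norm_nonneg l
    have hK : 0 ≤ 4 / m * (2 * C + ‖l‖) := by positivity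
    by_contra! hlt
    have hr : 1 ≤ ‖y - x₀‖ := by linarith
    have h4 : m / 4 * ‖y - x₀‖ ^ 2 ≤ (2 * C + ‖l‖) * ‖y - x₀‖ := by nlinarith
    have h5 : m / 4 * ‖y - x₀‖ ≤ 2 * C + ‖l‖ := by
      refine le_of_mul_le_mul_right ?_ (zero_lt_one.trans_le hr)
      linarith
    have h6 : ‖y - x₀‖ ≤ 4 / m * (2 * C + ‖l‖) := by
      rw [div_mul_eq_mul_div, le_div_iff₀ hm]
      linarith
    linarith
  -- Minimizing the height over the truncated epigraph uses only that the epigraph is closed, so `Q`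
  -- itself need not be.
  set P : Set (E × ℝ) := {p | p.1 ∈ Q ∧ h p.1 ≤ p.2} ∩ {p | p.2 ≤ h x₀} with hP
  have hPc : IsClosed P := hcl.inter (isClosed_le continuous_snd continuous_const)
  have hPsub : P ⊆ Metric.closedBall x₀ R ×ˢ Set.Icc (b + l x₀ - ‖l‖ * R) (h x₀) := by
    rintro ⟨y, r⟩ ⟨⟨hy, hyr⟩, hr⟩
    simp only [Set.mem_ofPred_eq] at hy hyr hr
    have h1 := hR y hy (hyr.trans hr)
    have h2 := (abs_le.1 (l.le_opNorm_of_le h1)).1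
    have h3 := hbl y hy
    rw [map_sub] at h2
    exact ⟨by simpa [dist_eq_norm] using h1, by constructor <;> linarith⟩
  have hPcomp : IsCompact P :=
    ((isCompact_closedBall x₀ R).prod isCompact_Icc).of_isClosed_subset hPc hPsub
  obtain ⟨⟨x, r⟩, ⟨⟨hx, hxr⟩, hr⟩, hmin⟩ :=
    hPcomp.exists_isMinOn ⟨(x₀, h x₀), ⟨hx₀, le_rfl⟩, le_refl (h x₀)⟩ continuous_snd.continuousOn
  refine ⟨x, hx, fun y hy => ?_⟩
  simp only [Set.mem_ofPred_eq] at hxr hr ⊢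
  rcases le_total (h y) (h x₀) with h1 | h1
  · exact hxr.trans (hmin (show (y, h y) ∈ P from ⟨⟨hy, le_rfl⟩, h1⟩))
  · exact (hxr.trans hr).trans h1

/-- The supremum defining the Fenchel dual of a closed strongly convex function is attained. -/
theorem IsClosedFunctionOn.exists_isMinOn_add_clm [FiniteDimensional ℝ E] {Q : Set E} {m : ℝ}
    {h : E → ℝ} (hcl : IsClosedFunctionOn Q h) (hh : StrongConvexOn Q m h) (hm : 0 < m)
    (hQ : Q.Nonempty) (s : E →L[ℝ] ℝ) :
    ∃ x ∈ Q, IsMinOn (fun w => h w + s w) Q x := by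
  have h1 : StrongConvexOn Q m (fun w => h w + s w) := by
    simpa using hh.const_mul_add_affine zero_le_one 0 s
  have h2 : IsClosedFunctionOn Q (fun w => h w + s w) := by
    have hc : Continuous fun p : E × ℝ => (p.1, p.2 - s p.1) := by fun_prop
    have := hcl.preimage hc
    simpa [IsClosedFunctionOn, Set.preimage, le_sub_iff_add_le] using this
  exact h2.exists_isMinOn h1 hm hQ

theorem fenchelDual_eq_of_isMinOn {Q : Set E} {h : E → ℝ} {s : E →L[ℝ] ℝ} {w : E} (hw : w ∈ Q)
    (hmin : IsMinOn (fun x => h x - s x) Q w) : fenchelDual Q h s = s w - h w := by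
  refine IsGreatest.csSup_eq ⟨⟨w, hw, rfl⟩, ?_⟩
  rintro _ ⟨x, hx, rfl⟩
  have : h w - s w ≤ h x - s x := hmin hx
  simp only
  linarith

/-- Adding the quadratic growth inequalities at the two minimizers cancels the values of `h` and
leaves `m ‖v - w‖² ≤ (t - s) (v - w)`. -/
theorem norm_sub_le_of_isMinOn_sub_clm {Q : Set E} {m : ℝ} {h : E → ℝ}
    (hh : StrongConvexOn Q m h) (hm : 0 < m) {s t : E →L[ℝ] ℝ} {w v : E} (hw : w ∈ Q) (hv : v ∈ Q)
    (hws : IsMinOn (fun x => h x - s x) Q w) (hvt : IsMinOn (fun x => h x - t x) Q v) :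
    ‖v - w‖ ≤ ‖t - s‖ / m := by
  have aux : ∀ r : E →L[ℝ] ℝ, StrongConvexOn Q m (fun x => h x - r x) := fun r => by
    simpa [sub_eq_add_neg] using hh.const_mul_add_affine zero_le_one 0 (-r)
  have h1 := (aux s).add_sq_le_of_isMinOn hw hws hv
  have h2 := (aux t).add_sq_le_of_isMinOn hv hvt hw
  have h3 := (le_abs_self _).trans ((t - s).le_opNorm (v - w))
  rw [norm_sub_rev w v] at h2
  simp only [_root_.sub_apply, map_sub] at h1 h2 h3
  rw [le_div_iff₀ hm]
  rcases (norm_nonneg (v - w)).eq_or_lt with h0 | h0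
  · rw [← h0, zero_mul]; exact norm_nonneg _
  · refine le_of_mul_le_mul_right ?_ h0
    linarith

/-- The Fenchel dual of a strongly convex function is differentiable, with the maximizer as its
gradient. -/
theorem hasFDerivAt_fenchelDual {Q : Set E} {m : ℝ} {h : E → ℝ}
    (hh : StrongConvexOn Q m h) (hm : 0 < m)
    (hex : ∀ s : E →L[ℝ] ℝ, ∃ x ∈ Q, IsMinOn (fun w => h w - s w) Q x)
    {s : E →L[ℝ] ℝ} {w : E} (hw : w ∈ Q) (hws : IsMinOn (fun x => h x - s x) Q w) :
    HasFDerivAt (fenchelDual Q h) (ContinuousLinearMap.apply ℝ ℝ w) s := by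
  refine HasFDerivAt.of_isLittleO (Asymptotics.IsBigO.trans_isLittleO
    (Asymptotics.IsBigO.of_bound m⁻¹ (Eventually.of_forall fun t => ?_))
    (Asymptotics.isLittleO_pow_sub_sub s one_lt_two))
  obtain ⟨v, hv, hvt⟩ := hex t
  rw [fenchelDual_eq_of_isMinOn hw hws, fenchelDual_eq_of_isMinOn hv hvt]
  -- Each maximizer competes in the other supremum, so the remainder lies between `0` and `(t - s)
  -- (v - w)`, which is quadratic in `‖t - s‖`.
  have h1 := norm_sub_le_of_isMinOn_sub_clm hh hm hw hv hws hvt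
  have h2 : h w - s w ≤ h v - s v := hws hv
  have h3 : h v - t v ≤ h w - t w := hvt hw
  have h4 := (le_abs_self _).trans ((t - s).le_opNorm_of_le h1)
  simp only [_root_.sub_apply, map_sub] at h4
  simp only [ContinuousLinearMap.apply_apply, _root_.sub_apply, Real.norm_eq_abs,
    abs_pow, abs_norm]
  have e : m⁻¹ * ‖t - s‖ ^ 2 = ‖t - s‖ * (‖t - s‖ / m) := by ring
  rw [e, abs_le]
  constructor <;> linarith

/-- The descent lemma. -/
theorem IsLCGOn.le_quadratic {Q : Set E} {f : E → ℝ} {L : ℝ} (hQ : Convex ℝ Q)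
    (hf : IsLCGOn Q f L) {x y : E} (hx : x ∈ Q) (hy : y ∈ Q) :
    f y ≤ f x + fderiv ℝ f x (y - x) + L / 2 * ‖y - x‖ ^ 2 := by
  -- The Lipschitz bound makes the derivative of `φ` nonpositive on `[0, 1]`; the claim is `φ 1 ≤ φ
  -- 0`.
  set φ : ℝ → ℝ := fun t => f (x + t • (y - x)) -
    (t * fderiv ℝ f x (y - x) + t ^ 2 * (L / 2 * ‖y - x‖ ^ 2)) with hφ
  have hmem : ∀ t ∈ Set.Icc (0 : ℝ) 1, x + t • (y - x) ∈ Q :=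
    fun t ht => hQ.add_smul_sub_mem hx hy ht
  have hder : ∀ t ∈ Set.Icc (0 : ℝ) 1, HasDerivAt φ (fderiv ℝ f (x + t • (y - x)) (y - x) -
      (fderiv ℝ f x (y - x) + 2 * t * (L / 2 * ‖y - x‖ ^ 2))) t := by
    intro t ht
    refine (hf.1 _ (hmem t ht)).hasDerivAt_comp_segment.sub (HasDerivAt.add ?_ ?_)
    · simpa using (hasDerivAt_id t).mul_const (fderiv ℝ f x (y - x))
    · simpa using (hasDerivAt_pow 2 t).mul_const (L / 2 * ‖y - x‖ ^ 2)
  have hanti : AntitoneOn φ (Set.Icc 0 1) := by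
    refine antitoneOn_of_deriv_nonpos (convex_Icc 0 1)
      (fun t ht => (hder t ht).continuousAt.continuousWithinAt)
      (fun t ht => (hder t (interior_subset ht)).differentiableAt.differentiableWithinAt)
      fun t ht => ?_
    replace ht := interior_subset ht
    rw [(hder t ht).deriv]
    have h1 := hf.2 _ (hmem t ht) x hx
    rw [add_sub_cancel_left, norm_smul, Real.norm_of_nonneg ht.1] at h1
    have h2 := (le_abs_self _).trans
      ((fderiv ℝ f (x + t • (y - x)) - fderiv ℝ f x).le_of_opNorm_le h1 (y - x))
    rw [_root_.sub_apply] at h2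
    linarith
  have h01 := hanti (Set.left_mem_Icc.2 zero_le_one) (Set.right_mem_Icc.2 zero_le_one) zero_le_one
  simp only [hφ, one_smul, zero_smul, add_sub_cancel, add_zero] at h01
  linarith

/-- Convexity of the squared norm, for two weights. -/
theorem add_mul_norm_sub_sq_le {p q : ℝ} (hp : 0 < p) (hq : 0 ≤ q) (y z x : E) :
    (p + q) * ‖y - (p + q)⁻¹ • (p • z + q • x)‖ ^ 2 ≤ p * ‖y - z‖ ^ 2 + q * ‖y - x‖ ^ 2 := by
  have hpq : 0 < p + q := by linarith
  have e : y - (p + q)⁻¹ • (p • z + q • x) = (p + q)⁻¹ • (p • (y - z) + q • (y - x)) := by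
    have : y = (p + q)⁻¹ • (p + q) • y := by rw [smul_smul, inv_mul_cancel₀ hpq.ne', one_smul]
    nth_rewrite 1 [this]
    module
  have h1 : ‖p • (y - z) + q • (y - x)‖ ≤ p * ‖y - z‖ + q * ‖y - x‖ := by
    refine (norm_add_le _ _).trans_eq ?_
    rw [norm_smul, norm_smul, Real.norm_of_nonneg hp.le, Real.norm_of_nonneg hq]
  have h2 := pow_le_pow_left₀ (norm_nonneg _) h1 2
  rw [e, norm_smul, Real.norm_of_nonneg (inv_nonneg.2 hpq.le), mul_pow]
  have e2 : (p + q) * ((p + q)⁻¹ ^ 2 * ‖p • (y - z) + q • (y - x)‖ ^ 2)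
      = ‖p • (y - z) + q • (y - x)‖ ^ 2 / (p + q) := by
    field_simp
  rw [e2, div_le_iff₀ hpq]
  -- The two sides differ by `p q (‖y - z‖ - ‖y - x‖)²` once the triangle inequality is squared.
  nlinarith [mul_nonneg (mul_nonneg hp.le hq) (sq_nonneg (‖y - z‖ - ‖y - x‖))]

end ConvexAnalysis

/-! ### Estimate sequence and growth of the weights -/

section AcceleratedGradient

variable {E : Type*} [NormedAddCommGroup E] [NormedSpace ℝ E]

theorem Convex.inv_smul_add_mem {Q : Set E} (hQ : Convex ℝ Q) {p q : ℝ} (hp : 0 ≤ p) (hq : 0 ≤ q)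
    (hpq : 0 < p + q) {x y : E} (hx : x ∈ Q) (hy : y ∈ Q) :
    (p + q)⁻¹ • (p • x + q • y) ∈ Q := by
  have := hQ hx hy (div_nonneg hp hpq.le) (div_nonneg hq hpq.le)
    (by rw [← add_div, div_self hpq.ne'])
  convert this using 1
  match_scalars <;> ring

/-- The estimation functions are a multiple of the prox-function plus an affine function. -/
theorem estimateFun_eq_affine {f d : E → ℝ} {μ : ℝ} {x₀ : E} {u : ℕ → E} {a S : ℕ → ℝ}
    (hS0 : S 0 = 0) (hS : ∀ k, S (k + 1) = S k + a (k + 1)) (k : ℕ) :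
    ∃ (b : ℝ) (l : E →L[ℝ] ℝ), ∀ y,
      estimateFun f (fun α => μ * d α) d 0 x₀ u a k y = (1 + μ * S k) * d y + (b + l y) := by
  induction k with
  | zero =>
    refine ⟨fderiv ℝ d x₀ x₀ - d x₀, -fderiv ℝ d x₀, fun y => ?_⟩
    simp only [estimateFun, bregman, hS0, map_sub, neg_apply]
    ring
  | succ k ih =>
    obtain ⟨b, l, h⟩ := ih
    refine ⟨b + a (k + 1) * (f (u (k + 1)) - fderiv ℝ f (u (k + 1)) (u (k + 1))),
      l + a (k + 1) • fderiv ℝ f (u (k + 1)), fun y => ?_⟩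
    simp only [estimateFun, lowerModel, h, hS k, map_sub, add_apply, smul_apply, smul_eq_mul]
    ring

theorem estimateFun_strongConvexOn {Q : Set E} {f d : E → ℝ} {μ σ : ℝ} {x₀ : E} {u : ℕ → E}
    {a S : ℕ → ℝ} (hS0 : S 0 = 0) (hS : ∀ k, S (k + 1) = S k + a (k + 1))
    (hd : StrongConvexOn Q σ d) {k : ℕ} (hk : 0 ≤ 1 + μ * S k) :
    StrongConvexOn Q ((1 + μ * S k) * σ) (estimateFun f (fun α => μ * d α) d 0 x₀ u a k) := by
  obtain ⟨b, l, h⟩ := estimateFun_eq_affine (f := f) (d := d) (μ := μ) (x₀ := x₀) (u := u) hS0 hS k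
  rw [funext h]
  exact hd.const_mul_add_affine hk b l

theorem estimateFun_exists_isMinOn {Q : Set E} {f d : E → ℝ} {μ : ℝ} {x₀ : E} {u : ℕ → E}
    {a S : ℕ → ℝ} (hS0 : S 0 = 0) (hS : ∀ k, S (k + 1) = S k + a (k + 1))
    (hQ : IsCompact Q) (hne : Q.Nonempty) (hd : LowerSemicontinuousOn d Q) {k : ℕ}
    (hk : 0 ≤ 1 + μ * S k) :
    ∃ z ∈ Q, IsMinOn (estimateFun f (fun α => μ * d α) d 0 x₀ u a k) Q z := by
  obtain ⟨b, l, h⟩ := estimateFun_eq_affine (f := f) (d := d) (μ := μ) (x₀ := x₀) (u := u) hS0 hS k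
  rw [funext h]
  have h1 : LowerSemicontinuousOn (fun y => (1 + μ * S k) * d y) Q :=
    (continuous_const_mul (1 + μ * S k)).comp_lowerSemicontinuousOn hd
      (monotone_mul_left_of_nonneg hk)
  have h2 : Continuous fun y => b + l y := by fun_prop
  exact (h1.add (h2.lowerSemicontinuous.lowerSemicontinuousOn Q)).exists_isMinOn hne hQ

namespace IsAGMEFInf

variable {Q : Set E} {f d : E → ℝ} {μ σ L : ℝ} {x₀ : E} {x u z : ℕ → E} {a S : ℕ → ℝ}

theorem weight_nonneg {Ψ : E → ℝ} {lam₁ lam₂ : ℝ}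
    (h : IsAGMEFInf Q f Ψ d lam₁ lam₂ σ L x₀ x u z a S) (k : ℕ) : 0 ≤ S k := by
  induction k with
  | zero => exact h.A_zero.ge
  | succ k ih => rw [h.A_succ]; linarith [h.a_pos k]

theorem weight_succ_pos {Ψ : E → ℝ} {lam₁ lam₂ : ℝ}
    (h : IsAGMEFInf Q f Ψ d lam₁ lam₂ σ L x₀ x u z a S) (k : ℕ) : 0 < S (k + 1) := by
  rw [h.A_succ]; linarith [h.a_pos k, h.weight_nonneg k]

theorem sum_weights {Ψ : E → ℝ} {lam₁ lam₂ : ℝ}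
    (h : IsAGMEFInf Q f Ψ d lam₁ lam₂ σ L x₀ x u z a S) (k : ℕ) :
    ∑ i ∈ Finset.Icc 1 k, a i = S k := by
  induction k with
  | zero => simp [h.A_zero]
  | succ k ih => rw [Finset.sum_Icc_succ_top (by omega), ih, h.A_succ]

theorem z_mem' {Ψ : E → ℝ} {lam₁ lam₂ : ℝ}
    (h : IsAGMEFInf Q f Ψ d lam₁ lam₂ σ L x₀ x u z a S) (hx₀ : x₀ ∈ Q) : ∀ k, z k ∈ Q
  | 0 => h.z_zero ▸ hx₀
  | k + 1 => h.z_mem k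

theorem x_mem {Ψ : E → ℝ} {lam₁ lam₂ : ℝ}
    (h : IsAGMEFInf Q f Ψ d lam₁ lam₂ σ L x₀ x u z a S) (hQ : Convex ℝ Q) (hx₀ : x₀ ∈ Q) (k : ℕ) :
    x k ∈ Q := by
  induction k with
  | zero => exact h.x_zero ▸ hx₀
  | succ k ih =>
    have hS := h.weight_succ_pos k
    rw [h.x_succ]
    rw [h.A_succ] at hS ⊢
    exact hQ.inv_smul_add_mem (h.weight_nonneg k) (h.a_pos k).le hS ih (h.z_mem k)

theorem tau_nonneg {Ψ : E → ℝ} {lam₁ lam₂ : ℝ}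
    (h : IsAGMEFInf Q f Ψ d lam₁ lam₂ σ L x₀ x u z a S) (hμ : 0 ≤ μ) (k : ℕ) :
    0 < 1 + μ * S k ∧ 0 ≤ μ * a (k + 1) * (S k / S (k + 1)) := by
  have h1 := h.weight_nonneg k
  have h2 := h.weight_succ_pos k
  have h3 := h.a_pos k
  exact ⟨by positivity, by positivity⟩

/-- `u_{k+1}` is a convex combination of `x_k` and of a convex combination of `z_k` and `x_k`. -/
theorem u_succ_eq {Ψ : E → ℝ} (h : IsAGMEFInf Q f Ψ d 0 μ σ L x₀ x u z a S) (hμ : 0 ≤ μ)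
    (k : ℕ) {p q : ℝ} (hp : p = 1 + μ * S k) (hq : q = μ * a (k + 1) * (S k / S (k + 1))) :
    u (k + 1) = (S (k + 1))⁻¹ •
      (S k • x k + a (k + 1) • (p + q)⁻¹ • (p • z k + q • x k)) := by
  have h0 := h.tau_nonneg hμ k
  rw [← hp, ← hq] at h0
  have hpq : p + q ≠ 0 := by linarith
  have hS := (h.weight_succ_pos k).ne'
  rw [h.u_succ k p 0 q (p + q) (by rw [hp, zero_add]) (by simp) hq (by ring)]
  match_scalars <;> field_simp <;> ring

theorem u_mem {Ψ : E → ℝ} (h : IsAGMEFInf Q f Ψ d 0 μ σ L x₀ x u z a S) (hμ : 0 ≤ μ)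
    (hQ : Convex ℝ Q) (hx₀ : x₀ ∈ Q) (k : ℕ) : u (k + 1) ∈ Q := by
  have h0 := h.tau_nonneg hμ k
  have hS := h.weight_succ_pos k
  rw [h.u_succ_eq hμ k rfl rfl, h.A_succ k]
  rw [h.A_succ] at hS h0
  exact hQ.inv_smul_add_mem (h.weight_nonneg k) (h.a_pos k).le hS (h.x_mem hQ hx₀ k)
    (hQ.inv_smul_add_mem h0.1.le h0.2 (by linarith) (h.z_mem' hx₀ k) (h.x_mem hQ hx₀ k))

/-- For `k ≥ 1` this is quadratic growth at the minimizer `z k`. For `k = 0` the function is the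
Bregman divergence at `x₀`, and first-order strong convexity of `d` is used instead. -/
theorem estimateFun_add_sq_le (h : IsAGMEFInf Q f (fun α => μ * d α) d 0 μ σ L x₀ x u z a S)
    (hμ : 0 ≤ μ) (hx₀ : x₀ ∈ Q) (hd : StrongConvexOn Q σ d) (hdiff : DifferentiableAt ℝ d x₀)
    (k : ℕ) {y : E} (hy : y ∈ Q) :
    estimateFun f (fun α => μ * d α) d 0 x₀ u a k (z k) +
      (1 + μ * S k) * σ / 2 * ‖y - z k‖ ^ 2 ≤ estimateFun f (fun α => μ * d α) d 0 x₀ u a k y := by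
  rcases k with _ | k
  · have := hd.first_order_le hx₀ hdiff hy
    simp only [estimateFun, bregman, h.z_zero, h.A_zero, sub_self, map_zero]
    linarith
  · exact (estimateFun_strongConvexOn h.A_zero h.A_succ hd
      (h.tau_nonneg hμ (k + 1)).1.le).add_sq_le_of_isMinOn (h.z_mem k) (h.z_isMinOn k) hy

/-- The estimate sequence property. -/
theorem mul_objective_le (h : IsAGMEFInf Q f (fun α => μ * d α) d 0 μ σ L x₀ x u z a S)
    (hμ : 0 ≤ μ) (hσ : 0 < σ) (hx₀ : x₀ ∈ Q) (hd : StrongConvexOn Q σ d)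
    (hdiff : DifferentiableAt ℝ d x₀) (hf : IsLCGOn Q f L)
    (hfc : ∀ v ∈ Q, ∀ y ∈ Q, f v + fderiv ℝ f v (y - v) ≤ f y) (k : ℕ) :
    S k * (f (x k) + μ * d (x k)) ≤ estimateFun f (fun α => μ * d α) d 0 x₀ u a k (z k) := by
  have hQ := hd.1
  induction k with
  | zero => simp [estimateFun, bregman, h.z_zero, h.A_zero]
  | succ k ih =>
    -- `p` and `q` are `τ₁` and `τ₃`. The descent error at `x'` is paid for by two terms: `p ‖z' - z
    -- k‖²` from the growth of the previous estimate function, and `q ‖z' - x k‖²` from the strong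
    -- convexity of `μ d` between `x k` and `z'`.
    obtain ⟨p, hp⟩ : ∃ p, p = 1 + μ * S k := ⟨_, rfl⟩
    obtain ⟨q, hq⟩ : ∃ q, q = μ * a (k + 1) * (S k / S (k + 1)) := ⟨_, rfl⟩
    obtain ⟨hp0, hq0⟩ := h.tau_nonneg hμ k
    rw [← hp] at hp0
    rw [← hq] at hq0
    have hpq : 0 < p + q := by linarith
    have hS0 := h.weight_nonneg k
    have hS1 := h.weight_succ_pos k
    have ha := h.a_pos k
    have hSa := h.A_succ k
    have hxk := h.x_mem hQ hx₀ k
    have hzk := h.z_mem k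
    have hxk' := h.x_mem hQ hx₀ (k + 1)
    have huk := h.u_mem hμ hQ hx₀ k
    have hux := h.u_succ_eq hμ k hp hq
    have hxx := h.x_succ k
    have hψ := h.estimateFun_add_sq_le hμ hx₀ hd hdiff k hzk
    have hroot := h.a_root k
    simp only [estimateFun, lowerModel, zero_mul, add_zero]
    generalize x (k + 1) = x' at *
    generalize z (k + 1) = z' at *
    generalize u (k + 1) = u' at *
    generalize S (k + 1) = S' at *
    generalize a (k + 1) = b at *
    generalize hw : (p + q)⁻¹ • (p • z k + q • x k) = w at *
    -- the linear model at the three points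
    have hlin : S' * (f u' + fderiv ℝ f u' (x' - u')) = S k * (f u' + fderiv ℝ f u' (x k - u')) +
        b * (f u' + fderiv ℝ f u' (z' - u')) := by
      have e : S' • (x' - u') = S k • (x k - u') + b • (z' - u') := by
        rw [hxx, hSa]
        rw [hSa] at hS1
        match_scalars <;> field_simp
        ring
      have e2 := congrArg (fderiv ℝ f u') e
      simp only [map_add, map_smul, smul_eq_mul] at e2
      rw [mul_add, e2, hSa]
      ring
    have hlow := mul_le_mul_of_nonneg_left (hfc u' huk (x k) hxk) hS0
    have hup := mul_le_mul_of_nonneg_left (hf.le_quadratic hQ huk hxk') hS1.le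
    -- strong convexity of the prox-function
    have hdc : S' * (μ * d x') + σ / 2 * (q * ‖z' - x k‖ ^ 2) ≤
        S k * (μ * d (x k)) + b * (μ * d z') := by
      have h1 := hd.2 hxk hzk (div_nonneg hS0 hS1.le) (div_nonneg ha.le hS1.le)
        (by rw [← add_div, ← hSa, div_self hS1.ne'])
      have e : x' = (S k / S') • x k + (b / S') • z' := by
        rw [hxx]
        match_scalars <;> ring
      rw [← e, norm_sub_rev] at h1
      have h2 := mul_le_mul_of_nonneg_left h1 (mul_nonneg hμ hS1.le)
      simp only [smul_eq_mul] at h2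
      have e2 : μ * S' * (S k / S' * d (x k) + b / S' * d z' -
          S k / S' * (b / S') * (σ / 2 * ‖z' - x k‖ ^ 2)) =
          S k * (μ * d (x k)) + b * (μ * d z') - σ / 2 * (q * ‖z' - x k‖ ^ 2) := by
        rw [hq]
        field_simp
      rw [e2] at h2
      linarith
    -- the distance between the extrapolated and the new point
    have hdist : S' * (L / 2 * ‖x' - u'‖ ^ 2) ≤
        σ / 2 * (p * ‖z' - z k‖ ^ 2 + q * ‖z' - x k‖ ^ 2) := by
      have e : x' - u' = (b / S') • (z' - w) := by
        rw [hxx, hux]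
        match_scalars <;> ring
      -- This is the quadratic equation defining `a (k + 1)`: it matches the descent error with the
      -- available squared distances.
      have e2 : L * b ^ 2 = σ * ((p + q) * S') := by
        rw [hp, hq]
        field_simp at hroot ⊢
        rw [hSa]
        linarith
      have hcv := add_mul_norm_sub_sq_le hp0 hq0 z' (z k) (x k)
      rw [hw] at hcv
      rw [e, norm_smul, Real.norm_of_nonneg (by positivity), mul_pow]
      have e3 : S' * (L / 2 * ((b / S') ^ 2 * ‖z' - w‖ ^ 2)) =
          σ / 2 * ((p + q) * ‖z' - w‖ ^ 2) := by
        field_simp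
        linear_combination ‖z' - w‖ ^ 2 * e2
      rw [e3]
      exact mul_le_mul_of_nonneg_left hcv (by positivity)
    rw [← hp] at hψ
    linarith

/-- The square root of the weights grows by the factor and by the summand given here. -/
theorem sqrt_weight_succ {Ψ : E → ℝ} (h : IsAGMEFInf Q f Ψ d 0 μ σ L x₀ x u z a S) (hμ : 0 ≤ μ)
    (hσ : 0 < σ) (hL : 0 < L) (k : ℕ) :
    √(S k) + √(σ / L) / 2 ≤ √(S (k + 1)) ∧
      √(S k) * (1 + √(μ * σ / L) / 2) ≤ √(S (k + 1)) := by
  have hS0 := h.weight_nonneg k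
  have hS1 := h.weight_succ_pos k
  have ha := h.a_pos k
  have hSa := h.A_succ k
  have hroot := h.a_root k
  have h1 : 0 < √(S (k + 1)) := Real.sqrt_pos.2 hS1
  have h2 : √(S k) ≤ √(S (k + 1)) := Real.sqrt_le_sqrt (by linarith)
  -- A difference of squares: a lower bound `c √(S (k + 1)) ≤ a (k + 1)` becomes an increment of at
  -- least `c / 2` for the square root.
  have ha2 : a (k + 1) = (√(S (k + 1)) - √(S k)) * (√(S (k + 1)) + √(S k)) := by
    have e1 := Real.sq_sqrt hS0
    have e2 := Real.sq_sqrt hS1.le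
    linear_combination e1 - e2 - hSa
  have ha3 : a (k + 1) ≤ (√(S (k + 1)) - √(S k)) * (2 * √(S (k + 1))) := by
    rw [ha2]
    exact mul_le_mul_of_nonneg_left (by linarith) (by linarith)
  -- In the factor `1 + μ * S k`, keeping only `1` yields the additive bound and keeping only `μ * S
  -- k` the multiplicative one.
  have hsq : a (k + 1) ^ 2 = σ / L * (S (k + 1) * (1 + μ * S k) + a (k + 1) * μ * S k) := by
    rw [hSa]
    field_simp at hroot ⊢
    linarith
  have hμS : 0 ≤ μ * S k := by positivity
  have hab : 0 ≤ a (k + 1) * μ * S k := by positivity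
  constructor
  · have h3 : √(σ / L) * √(S (k + 1)) ≤ a (k + 1) := by
      rw [← Real.sqrt_mul (by positivity)]
      refine Real.sqrt_le_iff.2 ⟨ha.le, ?_⟩
      rw [hsq]
      refine mul_le_mul_of_nonneg_left ?_ (by positivity)
      nlinarith
    have h4 := le_of_mul_le_mul_right (a := √(S (k + 1))) (b := √(σ / L))
      (c := 2 * (√(S (k + 1)) - √(S k))) (by linarith) h1
    linarith
  · have h3 : √(μ * σ / L) * √(S k) * √(S (k + 1)) ≤ a (k + 1) := by
      rw [← Real.sqrt_mul (by positivity), ← Real.sqrt_mul (by positivity)]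
      refine Real.sqrt_le_iff.2 ⟨ha.le, ?_⟩
      rw [hsq]
      have e : μ * σ / L * S k * S (k + 1) = σ / L * (S (k + 1) * (μ * S k)) := by ring
      rw [e]
      refine mul_le_mul_of_nonneg_left ?_ (by positivity)
      nlinarith
    have h4 := le_of_mul_le_mul_right (a := √(S (k + 1))) (b := √(μ * σ / L) * √(S k))
      (c := 2 * (√(S (k + 1)) - √(S k))) (by linarith) h1
    linarith

theorem weight_one {Ψ : E → ℝ} (h : IsAGMEFInf Q f Ψ d 0 μ σ L x₀ x u z a S)
    (hσ : 0 < σ) (hL : 0 < L) : S 1 = σ / L := by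
  have h1 := h.a_root 0
  have h2 : S 1 = S 0 + a 1 := h.A_succ 0
  have h3 : 0 < a 1 := h.a_pos 0
  simp only [zero_add, h.A_zero, zero_mul, mul_zero, add_zero, mul_one] at h1 h2
  rw [h2]
  field_simp at h1 ⊢
  nlinarith

/-- `√(S 1)` equals `√(σ / L)`, twice the guaranteed increment; hence `k + 2` and, in the theorem,
the `- 1` in the first iteration bound. -/
theorem sqrt_weight_ge_linear {Ψ : E → ℝ} (h : IsAGMEFInf Q f Ψ d 0 μ σ L x₀ x u z a S)
    (hμ : 0 ≤ μ) (hσ : 0 < σ) (hL : 0 < L) (k : ℕ) :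
    ((k : ℝ) + 2) / 2 * √(σ / L) ≤ √(S (k + 1)) := by
  induction k with
  | zero => rw [zero_add, h.weight_one hσ hL]; simp
  | succ k ih =>
    have := (h.sqrt_weight_succ hμ hσ hL (k + 1)).1
    push_cast
    linarith

/-- Geometric growth can start only at `S 1`, since `S 0 = 0`; hence the summand `1` in the second
iteration bound. -/
theorem sqrt_weight_ge_geometric {Ψ : E → ℝ} (h : IsAGMEFInf Q f Ψ d 0 μ σ L x₀ x u z a S)
    (hμ : 0 ≤ μ) (hσ : 0 < σ) (hL : 0 < L) (k : ℕ) :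
    √(σ / L) * (1 + √(μ * σ / L) / 2) ^ k ≤ √(S (k + 1)) := by
  induction k with
  | zero => rw [zero_add, h.weight_one hσ hL]; simp
  | succ k ih =>
    refine le_trans ?_ (h.sqrt_weight_succ hμ hσ hL (k + 1)).2
    rw [pow_succ, ← mul_assoc]
    exact mul_le_mul_of_nonneg_right ih (by positivity)

end IsAGMEFInf

end AcceleratedGradient

/-! ### Construction of a run -/

section AcceleratedGradientRun

variable {E : Type*} [NormedAddCommGroup E] [NormedSpace ℝ E]

/-- The positive root `a` of `(a + S) (μ S + 1) + a μ S = c a²`. -/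
noncomputable def agmWeight (μ c S : ℝ) : ℝ :=
  (1 + 2 * μ * S + √((1 + 2 * μ * S) ^ 2 + 4 * c * (S * (1 + μ * S)))) / (2 * c)

theorem agmWeight_pos {μ c S : ℝ} (hμ : 0 ≤ μ) (hc : 0 < c) (hS : 0 ≤ S) : 0 < agmWeight μ c S := by
  unfold agmWeight
  positivity

theorem agmWeight_root {μ c S : ℝ} (hμ : 0 ≤ μ) (hc : 0 < c) (hS : 0 ≤ S) :
    (agmWeight μ c S + S) * (μ * S + 1) + agmWeight μ c S * μ * S = c * agmWeight μ c S ^ 2 := by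
  have hsq : √((1 + 2 * μ * S) ^ 2 + 4 * c * (S * (1 + μ * S))) ^ 2 =
      (1 + 2 * μ * S) ^ 2 + 4 * c * (S * (1 + μ * S)) := Real.sq_sqrt (by positivity)
  unfold agmWeight
  generalize √((1 + 2 * μ * S) ^ 2 + 4 * c * (S * (1 + μ * S))) = r at *
  field_simp
  linear_combination -hsq

/-- The variables of AGM-EF-∞ after an iteration. -/
structure AGMState (E : Type*) where
  x : E
  u : E
  z : E
  a : ℝ
  S : ℝ
  ψ : E → ℝ

/-- One iteration of AGM-EF-∞ with `λ₁ = 0` and `Ψ = μ d`. -/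
noncomputable def AGMState.next (Q : Set E) (f d : E → ℝ) (μ c : ℝ) (p : AGMState E) :
    AGMState E :=
  let a := agmWeight μ c p.S
  let S := p.S + a
  let τ₁ := 1 + μ * p.S
  let τ₃ := μ * a * (p.S / S)
  let u := ((τ₁ + τ₃) * S)⁻¹ • ((a * τ₁) • p.z + ((τ₁ + τ₃) * p.S + τ₃ * a) • p.x)
  let ψ := fun y => p.ψ y + a * (μ * d y + lowerModel f d 0 y u)
  -- An arbitrary point if no minimizer exists; compactness of `Q` excludes this in
  -- `exists_isAGMEFInf`.
  let z := Classical.epsilon fun z => z ∈ Q ∧ IsMinOn ψ Q z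
  ⟨S⁻¹ • (p.S • p.x + a • z), u, z, a, S, ψ⟩

/-- The states of AGM-EF-∞ started at `x₀`. -/
noncomputable def agmState (Q : Set E) (f d : E → ℝ) (μ c : ℝ) (x₀ : E) : ℕ → AGMState E
  | 0 => ⟨x₀, x₀, x₀, 0, 0, fun y => bregman d y x₀⟩
  | k + 1 => (agmState Q f d μ c x₀ k).next Q f d μ c

/-- The state carries `ψ` so that one iteration needs no history; here it is matched with the
function built from the whole sequences. -/
theorem agmState_ψ (Q : Set E) (f d : E → ℝ) (μ c : ℝ) (x₀ : E) (k : ℕ) :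
    (agmState Q f d μ c x₀ k).ψ = estimateFun f (fun α => μ * d α) d 0 x₀
      (fun k => (agmState Q f d μ c x₀ k).u) (fun k => (agmState Q f d μ c x₀ k).a) k := by
  induction k with
  | zero => rfl
  | succ k ih =>
    funext y
    rw [estimateFun, ← ih]
    rfl

/-- AGM-EF-∞ can be run on a compact domain. -/
theorem exists_isAGMEFInf {Q : Set E} (f : E → ℝ) {d : E → ℝ} {μ σ L : ℝ} {x₀ : E}
    (hQ : IsCompact Q) (hx₀ : x₀ ∈ Q) (hd : LowerSemicontinuousOn d Q) (hμ : 0 ≤ μ) (hσ : 0 < σ)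
    (hL : 0 < L) :
    ∃ (x u z : ℕ → E) (a S : ℕ → ℝ),
      IsAGMEFInf Q f (fun α => μ * d α) d 0 μ σ L x₀ x u z a S := by
  set st := agmState Q f d μ (L * σ⁻¹) x₀ with hst
  have hc : 0 < L * σ⁻¹ := by positivity
  have hS : ∀ k, 0 ≤ (st k).S := fun k => by
    induction k with
    | zero => exact le_rfl
    | succ k ih => exact add_nonneg ih (agmWeight_pos hμ hc ih).le
  have hz : ∀ k, (st (k + 1)).z ∈ Q ∧ IsMinOn (st (k + 1)).ψ Q (st (k + 1)).z := fun k => by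
    have hex : ∃ z, z ∈ Q ∧ IsMinOn (st (k + 1)).ψ Q z := by
      rw [hst, agmState_ψ]
      exact estimateFun_exists_isMinOn (S := fun k => (st k).S) rfl (fun _ => rfl) hQ ⟨x₀, hx₀⟩ hd
        (by have := hS (k + 1); positivity)
    exact Classical.epsilon_spec hex
  refine ⟨fun k => (st k).x, fun k => (st k).u, fun k => (st k).z, fun k => (st k).a,
    fun k => (st k).S, ?_⟩
  exact
    { x_zero := rfl
      z_zero := rfl
      A_zero := rfl
      a_pos := fun k => agmWeight_pos hμ hc (hS k)
      a_root := fun k => by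
        simp only [zero_mul, zero_add]
        exact agmWeight_root hμ hc (hS k)
      A_succ := fun k => rfl
      u_succ := by
        rintro k _ _ _ _ rfl rfl rfl rfl
        simp only [zero_mul, zero_add, add_zero, sub_zero]
        rfl
      z_mem := fun k => (hz k).1
      z_isMinOn := fun k => by
        have := (hz k).2
        rwa [hst, agmState_ψ] at this
      x_succ := fun k => rfl }

end AcceleratedGradientRun

/-! ### The smoothed dual and the primal-dual gap -/

section SmoothedDual

variable {E₁ E₂ : Type*} [NormedAddCommGroup E₁] [NormedSpace ℝ E₁]
  [NormedAddCommGroup E₂] [NormedSpace ℝ E₂]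
  {Q₁ : Set E₁} {Q₂ : Set E₂} {Ω : E₁ → ℝ} {g d₂ : E₂ → ℝ} {A : E₁ →L[ℝ] E₂ →L[ℝ] ℝ}
  {lam σ₂ Lg L μ D M : ℝ}

theorem isMinOn_sub_neg_flip {α : E₂} {v : E₁} :
    IsMinOn (fun w => Ω w - (-(A.flip α)) w) Q₁ v ↔ IsMinOn (fun w => Ω w + A w α) Q₁ v := by
  simp only [neg_apply, ContinuousLinearMap.flip_apply, sub_neg_eq_add]

theorem dualSmoothPart_eq {α : E₂} {v : E₁} (hv : v ∈ Q₁)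
    (hmin : IsMinOn (fun w => Ω w + A w α) Q₁ v) :
    dualSmoothPart Q₁ Ω g A α = g α - Ω v - A v α := by
  rw [dualSmoothPart, fenchelDual_eq_of_isMinOn hv (isMinOn_sub_neg_flip.2 hmin)]
  simp only [neg_apply, ContinuousLinearMap.flip_apply]
  ring

theorem le_dualSmoothPart (hex : ∀ α : E₂, ∃ v ∈ Q₁, IsMinOn (fun w => Ω w + A w α) Q₁ v)
    (α : E₂) {w : E₁} (hw : w ∈ Q₁) : g α - Ω w - A w α ≤ dualSmoothPart Q₁ Ω g A α := by
  obtain ⟨v, hv, hmin⟩ := hex α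
  have : Ω v + A v α ≤ Ω w + A w α := hmin hw
  rw [dualSmoothPart_eq hv hmin]
  linarith

/-- Danskin's rule: the gradient of `Ω*` is the maximizer, and the chain rule through `-Aᵀ` turns it
into `-A v`. -/
theorem dualSmoothPart_hasFDerivAt (hΩ : StrongConvexOn Q₁ lam Ω) (hlam : 0 < lam)
    (hex : ∀ s : E₁ →L[ℝ] ℝ, ∃ x ∈ Q₁, IsMinOn (fun w => Ω w - s w) Q₁ x)
    {α : E₂} (hg : DifferentiableAt ℝ g α) {v : E₁} (hv : v ∈ Q₁)
    (hmin : IsMinOn (fun w => Ω w + A w α) Q₁ v) :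
    HasFDerivAt (dualSmoothPart Q₁ Ω g A) (fderiv ℝ g α - A v) α := by
  have h1 := hasFDerivAt_fenchelDual hΩ hlam hex hv (isMinOn_sub_neg_flip.2 hmin)
  have h2 : HasFDerivAt (fun β => -(A.flip β)) (-A.flip) α := A.flip.hasFDerivAt.neg
  have h3 := hg.hasFDerivAt.add (h1.comp α h2)
  have e : fderiv ℝ g α - A v =
      fderiv ℝ g α + (ContinuousLinearMap.apply ℝ ℝ v).comp (-A.flip) := by
    ext β
    simp [sub_eq_add_neg]
  rw [e]
  exact h3

/-- The primal minimizer is `‖A‖ / lam`-Lipschitz in `α`; applying `A` to it contributes the second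
factor `‖A‖`. -/
theorem dualSmoothPart_isLCGOn (hΩ : StrongConvexOn Q₁ lam Ω) (hlam : 0 < lam)
    (hex : ∀ s : E₁ →L[ℝ] ℝ, ∃ x ∈ Q₁, IsMinOn (fun w => Ω w - s w) Q₁ x)
    (hg : IsLCGOn Q₂ g Lg) :
    IsLCGOn Q₂ (dualSmoothPart Q₁ Ω g A) (‖A‖ ^ 2 / lam + Lg) := by
  have hex' : ∀ α : E₂, ∃ v ∈ Q₁, IsMinOn (fun w => Ω w + A w α) Q₁ v := fun α => by
    simpa only [isMinOn_sub_neg_flip] using hex (-(A.flip α))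
  constructor
  · intro α hα
    obtain ⟨v, hv, hmin⟩ := hex' α
    exact (dualSmoothPart_hasFDerivAt hΩ hlam hex (hg.1 α hα) hv hmin).differentiableAt
  · intro α hα β hβ
    obtain ⟨v, hv, hmin⟩ := hex' α
    obtain ⟨w, hw, hmin'⟩ := hex' β
    rw [(dualSmoothPart_hasFDerivAt hΩ hlam hex (hg.1 α hα) hv hmin).fderiv,
      (dualSmoothPart_hasFDerivAt hΩ hlam hex (hg.1 β hβ) hw hmin').fderiv]
    have h1 := norm_sub_le_of_isMinOn_sub_clm hΩ hlam hv hw (isMinOn_sub_neg_flip.2 hmin)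
      (isMinOn_sub_neg_flip.2 hmin')
    have h2 : ‖-(A.flip β) - -(A.flip α)‖ ≤ ‖A‖ * ‖α - β‖ := by
      rw [neg_sub_neg, ← map_sub, ← A.opNorm_flip]
      exact A.flip.le_opNorm _
    have h3 : ‖A (w - v)‖ ≤ ‖A‖ * (‖A‖ * ‖α - β‖ / lam) :=
      A.le_opNorm_of_le (h1.trans (by gcongr))
    have e : fderiv ℝ g α - A v - (fderiv ℝ g β - A w) =
        (fderiv ℝ g α - fderiv ℝ g β) + A (w - v) := by
      rw [map_sub]; abel
    rw [e]
    refine (norm_add_le _ _).trans ((add_le_add (hg.2 α hα β hβ) h3).trans_eq ?_)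
    ring

/-- The linear model of the smooth part at `u` lies below `g` minus the Lagrangian part at the
primal minimizer for `u`. -/
theorem dualSmoothPart_linear_le (hΩ : StrongConvexOn Q₁ lam Ω) (hlam : 0 < lam)
    (hex : ∀ s : E₁ →L[ℝ] ℝ, ∃ x ∈ Q₁, IsMinOn (fun w => Ω w - s w) Q₁ x)
    (hg : ConvexOn ℝ Q₂ g) {u : E₂} (hu : u ∈ Q₂) (hgu : DifferentiableAt ℝ g u) {v : E₁}
    (hv : v ∈ Q₁) (hmin : IsMinOn (fun w => Ω w + A w u) Q₁ v) {α : E₂} (hα : α ∈ Q₂) :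
    dualSmoothPart Q₁ Ω g A u + fderiv ℝ (dualSmoothPart Q₁ Ω g A) u (α - u) ≤
      g α - Ω v - A v α := by
  -- The terms `A v u` cancel, so only the gradient inequality for `g` remains.
  have h1 := (strongConvexOn_zero.2 hg).first_order_le hu hgu hα
  rw [(dualSmoothPart_hasFDerivAt hΩ hlam hex hgu hv hmin).fderiv, dualSmoothPart_eq hv hmin,
    _root_.sub_apply, map_sub (A v)]
  linarith

/-- Compactness makes the values bounded above, so that `sSup` is a true supremum and not its
default value `0`. -/
theorem le_fenchelDual {Q : Set E₂} (hQ : IsCompact Q) (hg : ContinuousOn g Q) (s : E₂ →L[ℝ] ℝ)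
    {α : E₂} (hα : α ∈ Q) : s α - g α ≤ fenchelDual Q g s :=
  le_csSup (hQ.image_of_continuousOn (s.continuous.continuousOn.sub hg)).bddAbove ⟨α, hα, rfl⟩

/-- `c i` stands for the bound `g α - Ω (v i) - A (v i) α` on the linear model at `u i`. -/
theorem estimateFun_le_sum {f Ψ d : E₂ → ℝ} {x₀ : E₂} {u : ℕ → E₂} {a : ℕ → ℝ} {α : E₂}
    {c : ℕ → ℝ} (ha : ∀ k, 0 ≤ a (k + 1))
    (hc : ∀ k, f (u (k + 1)) + fderiv ℝ f (u (k + 1)) (α - u (k + 1)) ≤ c (k + 1)) (k : ℕ) :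
    estimateFun f Ψ d 0 x₀ u a k α ≤
      bregman d α x₀ + ∑ i ∈ Finset.Icc 1 k, a i * (Ψ α + c i) := by
  induction k with
  | zero => simp [estimateFun]
  | succ k ih =>
    rw [Finset.sum_Icc_succ_top (by omega), estimateFun, lowerModel, zero_mul, add_zero]
    have := mul_le_mul_of_nonneg_left (hc k) (ha k)
    linarith

/-- The primal-dual gap of the scheme is at most `M / S_k` plus the smoothing error. -/
theorem IsPrimalDualScheme.isAccurateSolution {u₀ : E₂} {x u z : ℕ → E₂} {a S : ℕ → ℝ}
    {v : ℕ → E₁} (h : IsPrimalDualScheme Q₁ Q₂ Ω g d₂ A μ σ₂ L u₀ x u z a S v)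
    (hΩ : StrongConvexOn Q₁ lam Ω) (hlam : 0 < lam)
    (hex : ∀ s : E₁ →L[ℝ] ℝ, ∃ x ∈ Q₁, IsMinOn (fun w => Ω w - s w) Q₁ x)
    (hQ₂ : IsCompact Q₂) (hg : ConvexOn ℝ Q₂ g) (hg_diff : ∀ α ∈ Q₂, DifferentiableAt ℝ g α)
    (hf : IsLCGOn Q₂ (dualSmoothPart Q₁ Ω g A) L) (hμ : 0 ≤ μ)
    (hσ₂ : 0 < σ₂) (hd₂ : StrongConvexOn Q₂ σ₂ d₂) (hd₂_nonneg : ∀ α ∈ Q₂, 0 ≤ d₂ α)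
    (hd₂_le : ∀ α ∈ Q₂, d₂ α ≤ D) (hu₀ : u₀ ∈ Q₂) (hd₂_diff : DifferentiableAt ℝ d₂ u₀)
    (hM : ∀ α ∈ Q₂, bregman d₂ α u₀ ≤ M) {k : ℕ} (hk : 1 ≤ k) :
    IsAccurateSolution Q₁ (primalObj Q₂ Ω g A) (μ * D + M / S k) (primalIterate a S v k) := by
  have hex' : ∀ α : E₂, ∃ v ∈ Q₁, IsMinOn (fun w => Ω w + A w α) Q₁ v := fun α => by
    simpa only [isMinOn_sub_neg_flip] using hex (-(A.flip α))
  have hagm := h.agm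
  have hS : 0 < S k := by
    obtain ⟨j, rfl⟩ := Nat.exists_eq_add_of_le' hk
    exact hagm.weight_succ_pos j
  have hgc : ContinuousOn g Q₂ := fun α hα => (hg_diff α hα).continuousAt.continuousWithinAt
  have hu := hagm.u_mem hμ hd₂.1 hu₀
  have hfc : ∀ p ∈ Q₂, ∀ y ∈ Q₂, dualSmoothPart Q₁ Ω g A p +
      fderiv ℝ (dualSmoothPart Q₁ Ω g A) p (y - p) ≤ dualSmoothPart Q₁ Ω g A y := by
    intro p hp y hy
    obtain ⟨w, hw, hmin⟩ := hex' p
    exact (dualSmoothPart_linear_le hΩ hlam hex hg hp (hg_diff p hp) hw hmin hy).trans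
      (le_dualSmoothPart hex' y hw)
  have hsum : ∑ i ∈ Finset.Icc 1 k, (S k)⁻¹ * a i = 1 := by
    rw [← Finset.mul_sum, hagm.sum_weights, inv_mul_cancel₀ hS.ne']
  have ha : ∀ i ∈ Finset.Icc 1 k, 0 ≤ (S k)⁻¹ * a i := fun i hi => by
    obtain ⟨j, rfl⟩ := Nat.exists_eq_add_of_le' (Finset.mem_Icc.1 hi).1
    exact mul_nonneg (inv_nonneg.2 hS.le) (hagm.a_pos j).le
  have hvmem : ∀ i ∈ Finset.Icc 1 k, v i ∈ Q₁ := fun i hi => by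
    obtain ⟨j, rfl⟩ := Nat.exists_eq_add_of_le' (Finset.mem_Icc.1 hi).1
    exact h.v_mem j
  have hw : primalIterate a S v k = ∑ i ∈ Finset.Icc 1 k, ((S k)⁻¹ * a i) • v i := by
    simp only [primalIterate, Finset.smul_sum, smul_smul]
  have hwmem : primalIterate a S v k ∈ Q₁ := hw ▸ hΩ.1.sum_mem ha hsum hvmem
  have hΩw : S k * Ω (primalIterate a S v k) ≤ ∑ i ∈ Finset.Icc 1 k, a i * Ω (v i) := by
    have h1 := (strongConvexOn_zero.1 (hΩ.mono hlam.le)).map_sum_le ha hsum hvmem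
    rw [← hw] at h1
    have h2 := mul_le_mul_of_nonneg_left h1 hS.le
    rw [Finset.mul_sum] at h2
    refine h2.trans_eq (Finset.sum_congr rfl fun i _ => ?_)
    rw [smul_eq_mul, ← mul_assoc, ← mul_assoc, mul_inv_cancel₀ hS.ne', one_mul]
  have hAw : ∀ α, ∑ i ∈ Finset.Icc 1 k, a i * A (v i) α = S k * A (primalIterate a S v k) α := by
    intro α
    have h1 := congrArg (fun w => A w α) (show S k • primalIterate a S v k =
      ∑ i ∈ Finset.Icc 1 k, a i • v i by rw [primalIterate, smul_inv_smul₀ hS.ne'])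
    simpa [map_sum] using h1.symm
  have hx := hagm.x_mem hd₂.1 hu₀ k
  refine ⟨hwmem, fun w hwQ => ?_⟩
  -- The chain `S_k (f + μ d₂)(x_k) ≤ ψ_k(z_k) ≤ ψ_k(α)` holds for each `α`, so the bound is uniform
  -- in `α` and passes to the supremum defining `g*`.
  have hgap : ∀ α ∈ Q₂, A (primalIterate a S v k) α - g α ≤
      M / S k + μ * D - Ω (primalIterate a S v k) - dualSmoothPart Q₁ Ω g A (x k) := by
    intro α hα
    have h1 := hagm.mul_objective_le hμ hσ₂ hu₀ hd₂ hd₂_diff hf hfc k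
    have h2 := hagm.estimateFun_add_sq_le hμ hu₀ hd₂ hd₂_diff k hα
    have h3 := estimateFun_le_sum (f := dualSmoothPart Q₁ Ω g A) (Ψ := fun α => μ * d₂ α) (d := d₂)
      (x₀ := u₀) (u := u) (a := a) (α := α) (c := fun i => g α - Ω (v i) - A (v i) α)
      (fun k => (hagm.a_pos k).le) (fun k => dualSmoothPart_linear_le hΩ hlam hex hg (hu k)
        (hg_diff _ (hu k)) (h.v_mem k) (h.v_isMinOn k) hα) k
    have h4 : ∑ i ∈ Finset.Icc 1 k, a i * (μ * d₂ α + (g α - Ω (v i) - A (v i) α)) =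
        S k * (μ * d₂ α + g α) - ∑ i ∈ Finset.Icc 1 k, a i * Ω (v i) -
          S k * A (primalIterate a S v k) α := by
      rw [← hAw, ← hagm.sum_weights k, Finset.sum_mul, ← Finset.sum_sub_distrib,
        ← Finset.sum_sub_distrib]
      exact Finset.sum_congr rfl fun i _ => by ring
    have h5 : 0 ≤ (1 + μ * S k) * σ₂ / 2 * ‖α - z k‖ ^ 2 := by positivity
    have h6 := mul_le_mul_of_nonneg_left
      (mul_le_mul_of_nonneg_left (hd₂_le α hα) hμ) hS.le
    have h7 : 0 ≤ S k * (μ * d₂ (x k)) := mul_nonneg hS.le (mul_nonneg hμ (hd₂_nonneg _ hx))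
    have h8 : S k * (A (primalIterate a S v k) α - g α) ≤ S k *
        (M / S k + μ * D - Ω (primalIterate a S v k) - dualSmoothPart Q₁ Ω g A (x k)) := by
      have e : S k * (M / S k) = M := mul_div_cancel₀ M hS.ne'
      have := hM α hα
      rw [h4] at h3
      simp only [mul_sub, mul_add, e] at h1 h3 ⊢
      linarith
    exact le_of_mul_le_mul_left h8 hS
  have hdual : fenchelDual Q₂ g (A (primalIterate a S v k)) ≤
      M / S k + μ * D - Ω (primalIterate a S v k) - dualSmoothPart Q₁ Ω g A (x k) := by
    refine csSup_le ⟨_, u₀, hu₀, rfl⟩ ?_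
    rintro _ ⟨α, hα, rfl⟩
    exact hgap α hα
  have h1 := le_dualSmoothPart (g := g) hex' (x k) hwQ
  -- Together with `h1` this is weak duality: `-f(x_k) ≤ J(w)`.
  have h2 := le_fenchelDual hQ₂ hgc (A w) hx
  simp only [primalObj]
  linarith

end SmoothedDual

/-! ### Iteration count and conclusion -/

/-- Enough iterations make the weight at least `M / ε`. -/
theorem le_mul_weight_of_iterations {lam N M σ ε D S : ℝ} {j : ℕ} (hlam : 0 < lam) (hN : 0 < N)
    (hσ : 0 < σ) (hε : 0 < ε) (hD : 0 < D) (hS : 0 ≤ S)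
    (hlin : ((j : ℝ) + 2) / 2 * √(σ / (N / lam)) ≤ √S)
    (hgeo : √(σ / (N / lam)) * (1 + √(ε / D * σ / (N / lam)) / 2) ^ j ≤ √S)
    (hj : min (1 / √ε * √(4 * M * N / (lam * σ)) - 1)
      (1 + 1 / 2 * (Real.log (4 * M * N / (lam * σ * ε)) /
        Real.log (1 + √(lam * ε * σ / (4 * D * N))))) ≤ (j : ℝ) + 1) :
    M ≤ ε * S := by
  -- The logarithmic branch needs a positive argument; for `M ≤ 0` there is nothing to prove.
  rcases le_or_gt M 0 with hM | hM
  · exact hM.trans (by positivity)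
  have hρ : √(σ / (N / lam)) ^ 2 = σ * lam / N := by
    rw [Real.sq_sqrt (by positivity)]; field_simp
  have hsS := Real.sq_sqrt hS
  rcases min_le_iff.1 hj with h | h
  · have hε' : 0 < √ε := Real.sqrt_pos.2 hε
    have h1 : √(4 * M * N / (lam * σ)) ≤ ((j : ℝ) + 2) * √ε := by
      rw [one_div, sub_le_iff_le_add, inv_mul_le_iff₀ hε'] at h
      linarith
    have h2 := (Real.sqrt_le_left (by positivity)).1 h1
    rw [mul_pow, Real.sq_sqrt hε.le] at h2
    have h3 := pow_le_pow_left₀ (by positivity) hlin 2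
    rw [mul_pow, hρ, hsS] at h3
    have h4 := mul_le_mul_of_nonneg_left h3 hε.le
    refine le_trans ?_ h4
    rw [div_le_iff₀ (by positivity)] at h2
    have e : ε * ((((j : ℝ) + 2) / 2) ^ 2 * (σ * lam / N)) =
        (((j : ℝ) + 2) ^ 2 * ε * (lam * σ)) / (4 * N) := by
      field_simp
      norm_num
    rw [e, le_div_iff₀ (by positivity)]
    linarith
  · set q := √(lam * ε * σ / (4 * D * N)) with hq
    have hq0 : 0 < q := Real.sqrt_pos.2 (by positivity)
    -- The `4` under the root in the statement is the halving in the growth factor.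
    have hq2 : √(ε / D * σ / (N / lam)) / 2 = q := by
      rw [div_eq_iff two_ne_zero, hq]
      have e : ε / D * σ / (N / lam) = lam * ε * σ / (4 * D * N) * 2 ^ 2 := by
        field_simp
        norm_num
      rw [e, Real.sqrt_mul (by positivity), Real.sqrt_sq (by norm_num)]
    have hlog : 0 < Real.log (1 + q) := Real.log_pos (by linarith)
    have h1 : Real.log (4 * M * N / (lam * σ * ε)) / Real.log (1 + q) ≤ 2 * j := by linarith
    rw [div_le_iff₀ hlog] at h1
    have h2 : 4 * M * N / (lam * σ * ε) ≤ (1 + q) ^ (2 * j) := by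
      refine (Real.log_le_log_iff (by positivity) (by positivity)).1 ?_
      rw [Real.log_pow]
      push_cast
      exact h1
    rw [hq2] at hgeo
    have h3 := pow_le_pow_left₀ (by positivity) hgeo 2
    rw [mul_pow, hρ, hsS, ← pow_mul, mul_comm j 2] at h3
    have h4 : σ * lam / N * (4 * M * N / (lam * σ * ε)) ≤ S :=
      (mul_le_mul_of_nonneg_left h2 (by positivity)).trans h3
    -- The geometric branch gives four times the weight required.
    have e : σ * lam / N * (4 * M * N / (lam * σ * ε)) = 4 * M / ε := by field_simp
    rw [e, div_le_iff₀ hε] at h4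
    linarith

theorem mainTheorem6
    {E₁ E₂ : Type*} [NormedAddCommGroup E₁] [NormedSpace ℝ E₁] [FiniteDimensional ℝ E₁]
    [NormedAddCommGroup E₂] [NormedSpace ℝ E₂] [FiniteDimensional ℝ E₂]
    (Q₁ : Set E₁) (Q₂ : Set E₂) (Ω : E₁ → ℝ) (g d₂ : E₂ → ℝ)
    (A : E₁ →L[ℝ] E₂ →L[ℝ] ℝ) (lam σ₂ Lg D M ε : ℝ) (u₀ : E₂)
    -- the regularizer
    (hQ₁ : Q₁.Nonempty) (hlam : 0 < lam) (hΩ : StrongConvexOn Q₁ lam Ω)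
    (hΩ_closed : IsClosedFunctionOn Q₁ Ω)
    -- the function inducing the empirical risk
    (hQ₂ : IsClosed Q₂) (hg : ConvexOn ℝ Q₂ g) (hg_lcg : IsLCGOn Q₂ g Lg)
    -- the prox-function on the dual domain
    (hσ₂ : 0 < σ₂) (hd₂ : StrongConvexOn Q₂ σ₂ d₂) (hd₂_lsc : LowerSemicontinuousOn d₂ Q₂)
    (hd₂_min : IsLeast (d₂ '' Q₂) 0) (hD : IsLUB (d₂ '' Q₂) D) (hD_pos : 0 < D)
    (hL : 0 < ‖A‖ ^ 2 / lam + Lg)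
    -- the initial point
    (hu₀ : u₀ ∈ Q₂) (hd₂_diff : DifferentiableAt ℝ d₂ u₀)
    (hM : IsLUB ((fun α => bregman d₂ α u₀) '' Q₂) M)
    (hε : 0 < ε) :
    -- the gradient of `f` is Lipschitz with the constant used by the method
    IsLCGOn Q₂ (dualSmoothPart Q₁ Ω g A) (‖A‖ ^ 2 / lam + Lg) ∧
    -- the method can be run from `u₀`
    (∃ (x u z : ℕ → E₂) (a S : ℕ → ℝ) (v : ℕ → E₁),
      IsPrimalDualScheme Q₁ Q₂ Ω g d₂ A (ε / D) σ₂ (‖A‖ ^ 2 / lam + Lg) u₀ x u z a S v) ∧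
    -- every run from `u₀` gives a `2ε`-accurate solution
    ∀ (x u z : ℕ → E₂) (a S : ℕ → ℝ) (v : ℕ → E₁),
      IsPrimalDualScheme Q₁ Q₂ Ω g d₂ A (ε / D) σ₂ (‖A‖ ^ 2 / lam + Lg) u₀ x u z a S v →
      ∀ k : ℕ, 1 ≤ k →
        min
          (1 / √ε * √(4 * M * (‖A‖ ^ 2 + lam * Lg) / (lam * σ₂)) - 1)
          (1 + 1 / 2 * (Real.log (4 * M * (‖A‖ ^ 2 + lam * Lg) / (lam * σ₂ * ε)) /
            Real.log (1 + √(lam * ε * σ₂ / (4 * D * (‖A‖ ^ 2 + lam * Lg)))))) ≤ (k : ℝ) →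
        IsAccurateSolution Q₁ (primalObj Q₂ Ω g A) (2 * ε) (primalIterate a S v k) := by
  have hex : ∀ s : E₁ →L[ℝ] ℝ, ∃ v ∈ Q₁, IsMinOn (fun w => Ω w - s w) Q₁ v := fun s => by
    simpa [← sub_eq_add_neg] using hΩ_closed.exists_isMinOn_add_clm hΩ hlam hQ₁ (-s)
  have hex' : ∀ α : E₂, ∃ v ∈ Q₁, IsMinOn (fun w => Ω w + A w α) Q₁ v := fun α => by
    simpa only [isMinOn_sub_neg_flip] using hex (-(A.flip α))
  have hf := dualSmoothPart_isLCGOn (A := A) hΩ hlam hex hg_lcg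
  have hμ : 0 ≤ ε / D := by positivity
  have hd₂_nonneg : ∀ α ∈ Q₂, 0 ≤ d₂ α := fun α hα => hd₂_min.2 ⟨α, hα, rfl⟩
  have hd₂_le : ∀ α ∈ Q₂, d₂ α ≤ D := fun α hα => hD.1 ⟨α, hα, rfl⟩
  -- Quadratic growth of `d₂` from its minimizer, together with `d₂ ≤ D`, confines `Q₂` to a ball of
  -- radius `√(2 * D / σ₂)`.
  have hcomp : IsCompact Q₂ := by
    obtain ⟨β, hβ, hβ0⟩ := hd₂_min.1
    refine (isCompact_closedBall β (√(2 * D / σ₂))).of_isClosed_subset hQ₂ fun α hα => ?_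
    have h1 := hd₂.add_sq_le_of_isMinOn hβ (fun y hy => hβ0.le.trans (hd₂_nonneg y hy)) hα
    rw [mem_closedBall_iff_norm]
    refine Real.le_sqrt_of_sq_le ?_
    rw [le_div_iff₀ hσ₂]
    linarith [hd₂_le α hα]
  refine ⟨hf, ?_, fun x u z a S v h k hk hkN => ?_⟩
  · obtain ⟨x, u, z, a, S, h⟩ :=
      exists_isAGMEFInf (dualSmoothPart Q₁ Ω g A) hcomp hu₀ hd₂_lsc hμ hσ₂ hL
    choose w hw hmin using hex'
    exact ⟨x, u, z, a, S, fun i => w (u i), h, fun i => hw _, fun i => hmin _⟩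
  · have hacc := h.isAccurateSolution hΩ hlam hex hcomp hg hg_lcg.1 hf hμ hσ₂ hd₂ hd₂_nonneg hd₂_le
      hu₀ hd₂_diff (fun α hα => hM.1 ⟨α, hα, rfl⟩) hk
    refine ⟨hacc.1, fun w hw => (hacc.2 w hw).trans ?_⟩
    obtain ⟨j, rfl⟩ := Nat.exists_eq_add_of_le' hk
    have hS := h.agm.weight_succ_pos j
    have hlin := h.agm.sqrt_weight_ge_linear hμ hσ₂ hL j
    have hgeo := h.agm.sqrt_weight_ge_geometric hμ hσ₂ hL j
    have eL : ‖A‖ ^ 2 / lam + Lg = (‖A‖ ^ 2 + lam * Lg) / lam := by field_simp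
    rw [eL] at hL hlin hgeo
    have hN : 0 < ‖A‖ ^ 2 + lam * Lg := by
      have := mul_pos hL hlam
      rwa [div_mul_cancel₀ _ hlam.ne'] at this
    have hMS : M ≤ ε * S (j + 1) :=
      le_mul_weight_of_iterations hlam hN hσ₂ hε hD_pos hS.le hlin hgeo (by push_cast at hkN; exact hkN)
    have h1 : M / S (j + 1) ≤ ε := (div_le_iff₀ hS).2 hMS
    -- The smoothing error `μ D` is exactly `ε`; the other `ε` is the bound on `M / S_k`.
    rw [div_mul_cancel₀ _ hD_pos.ne']
    linarith
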